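/- Let $H$ be a compact topological group with Haar measure $\mu$, let $\mathcal H$ be a complex Hilbert space, and let $H$ act on $\mathcal H'=L^2(H,\mathcal H)$ by $(h\cdot f)(x)=f(h^{-1}x)$. Let $\widehat{\mathcal F}(\mathcal H')$ be the space, with the norm topology, of all bounded self-adjoint Fredholm operators on $\mathcal H'$ that are equivariant, i.e. commute with the action of every element of $H$. Let $B:[0,1]\to\widehat{\mathcal F}(\mathcal H')$ be a continuous path. A good grid for $B$ consists of a partition $0=t_0<t_1<\dots<t_n=1$ and of real numbers $a_1,\dots,a_n>0$ such that, for each $j$, the map $t\mapsto \chi_{[-a_j,a_j]}(B(t))$ (spectral projection) is norm continuous with values of finite rank on $[t_{j-1},t_j]$. For $h\in H$ the $h$-equivariant spectral flow of $B$ is $$\mathrm{sf}_h(B)=\sum_{j=1}^n\Big[\mathrm{Tr}\big(h|_{\mathbb E_j(t_j)}\big)-\mathrm{Tr}\big(h|_{\mathbb E_j(t_{j-1})}\big)\Big]\in\mathbb C,\qquad \mathbb E_j(t)=\operatorname{ran}\chi_{[0,a_j]}(B(t)),$$ where $(t_j),(a_j)$ is a good grid for $B$. Then $\mathrm{sf}_h$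 is a homotopy invariant. That is, let $h\in H$, and let $B,B':[0,1]\to\widehat{\mathcal F}(\mathcal H')$ be continuous paths with $B(0)=B'(0)$ and $B(1)=B'(1)$ that are homotopic through continuous paths in $\widehat{\mathcal F}(\mathcal H')$ with the same endpoints. Then the spectral flow is well defined (a good grid exists for $B$, and the sum above is the same for every good grid for $B$), and $$\mathrm{sf}_h(B)=\mathrm{sf}_h(B').$$ -/

import Mathlib

open MeasureTheory

noncomputable section

namespace EquivariantSpectralFlow

/-! ### The `H`-module `L²(H, 𝓗)` -/

section Regular

variable {H : Type*} [Group H] [TopologicalSpace H] [IsTopologicalGroup H]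
  [MeasurableSpace H] [BorelSpace H]

/-- The natural action of `H` on `L²(H, 𝓗)`: the isometries `(h · f)(x) = f (h⁻¹ x)`. -/
def regularRep (μ : Measure H) [μ.IsHaarMeasure]
    (𝓗 : Type*) [NormedAddCommGroup 𝓗] [InnerProductSpace ℂ 𝓗] :
    H →* (Lp 𝓗 2 μ →L[ℂ] Lp 𝓗 2 μ) where
  toFun h := (Lp.compMeasurePreservingₗᵢ ℂ (fun x : H => h⁻¹ * x)
    (measurePreserving_mul_left μ h⁻¹)).toContinuousLinearMap
  map_one' := by
    ext1 f
    change Lp.compMeasurePreserving (fun x : H => (1 : H)⁻¹ * x) _ f = f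
    have e : (fun x : H => (1 : H)⁻¹ * x) = id := by funext x; simp
    simp only [e, Lp.compMeasurePreserving_id_apply]
  map_mul' g h := by
    ext1 f
    change Lp.compMeasurePreserving (fun x : H => (g * h)⁻¹ * x) _ f
      = Lp.compMeasurePreserving (fun x : H => g⁻¹ * x) (measurePreserving_mul_left μ g⁻¹)
        (Lp.compMeasurePreserving (fun x : H => h⁻¹ * x) (measurePreserving_mul_left μ h⁻¹) f)
    rw [← Lp.compMeasurePreserving_comp_apply]
    have e : (fun x : H => (g * h)⁻¹ * x) = (fun x : H => h⁻¹ * x) ∘ (fun x : H => g⁻¹ * x) := by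
      funext x; simp [mul_assoc]
    simp only [e]

end Regular

section Hilbert

variable {E : Type*} [NormedAddCommGroup E] [InnerProductSpace ℂ E] [CompleteSpace E]

/-! ### Spectral projections of bounded self-adjoint operators -/

/-- For a bounded self-adjoint `T` and a closed `K ⊆ ℝ`, the spectral subspace of `T` for `K`, that
is the range of the spectral projection `χ_K(T)`. Since `1 - χ_K` is the supremum of the
continuous functions with values in `[0, 1]` that vanish on `K`, it is the set of vectors that
are annihilated by `f(T)` for all continuous `f : ℝ → ℝ` that vanish on `K`. -/
def spectralSubspace (T : E →L[ℂ] E) (K : Set ℝ) : Submodule ℂ E where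
  carrier := {x | ∀ f : ℝ → ℝ, Continuous f → (∀ r ∈ K, f r = 0) → (cfc f T) x = 0}
  add_mem' hx hy f hf h0 := by rw [map_add, hx f hf h0, hy f hf h0, add_zero]
  zero_mem' f _ _ := map_zero _
  smul_mem' c x hx f hf h0 := by rw [map_smul, hx f hf h0, smul_zero]

theorem isClosed_spectralSubspace (T : E →L[ℂ] E) (K : Set ℝ) :
    IsClosed (spectralSubspace T K : Set E) := by
  have : (spectralSubspace T K : Set E) =
      ⋂ (f : ℝ → ℝ) (_ : Continuous f) (_ : ∀ r ∈ K, f r = 0), {x | (cfc f T) x = 0} := by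
    ext x; simp [spectralSubspace]
  rw [this]
  exact isClosed_iInter fun f => isClosed_iInter fun _ => isClosed_iInter fun _ =>
    isClosed_eq (cfc f T).continuous continuous_const

instance (T : E →L[ℂ] E) (K : Set ℝ) : CompleteSpace (spectralSubspace T K) :=
  (isClosed_spectralSubspace T K).completeSpace_coe

/-- The spectral projection `χ_K(T)` of a bounded self-adjoint operator `T`, `K` closed. -/
def spectralProjection (T : E →L[ℂ] E) (K : Set ℝ) : E →L[ℂ] E :=
  (spectralSubspace T K).starProjection

/-- An operator that commutes with `T` preserves the spectral subspaces of `T`. -/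
theorem mem_spectralSubspace_of_commute {T U : E →L[ℂ] E} (hU : Commute T U) (K : Set ℝ)
    (x : E) (hx : x ∈ spectralSubspace T K) : U x ∈ spectralSubspace T K := by
  intro f hf h0
  have hc : (cfc f T) (U x) = U ((cfc f T) x) :=
    congrArg (fun A : E →L[ℂ] E => A x) (hU.cfc_real f).eq
  rw [hc, hx f hf h0, map_zero]

/-! ### Self-adjoint equivariant Fredholm operators and their spectral flow -/

variable {H : Type*} [Group H] (ρ : H →* (E →L[ℂ] E))

/-- The self-adjoint `H`-equivariant (i.e. commuting with the `H`-action) bounded Fredholm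
operators; as a subtype of `E →L[ℂ] E` this space carries the norm topology. -/
def saFredholm : Set (E →L[ℂ] E) :=
  {T | IsSelfAdjoint T ∧ T.IsFredholm ∧ ∀ h : H, Commute T (ρ h)}

variable {ρ}

/-- The trace `Tr (h|_{𝔼})` on the spectral subspace `𝔼 = ran χ_{[0, a]}(T)`. -/
def spectralTrace (h : H) (T : saFredholm ρ) (a : ℝ) : ℂ :=
  LinearMap.trace ℂ (spectralSubspace (T : E →L[ℂ] E) (Set.Icc 0 a))
    ((ρ h : E →ₗ[ℂ] E).restrict
      (mem_spectralSubspace_of_commute (T.2.2.2 h) (Set.Icc 0 a)))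

/-- A grid: a partition `0 = t₀ < t₁ < ⋯ < tₙ = 1` of the `x`-axis together with heights
`a₁, …, aₙ > 0` on the `y`-axis; `a j` belongs to the interval `[t j, t (j + 1)]`. -/
structure Grid where
  n : ℕ
  t : Fin (n + 1) → unitInterval
  a : Fin n → ℝ
  strictMono_t : StrictMono t
  t_zero : t 0 = 0
  t_last : t (Fin.last n) = 1
  a_pos : ∀ j, 0 < a j

variable {x y : saFredholm ρ}

/-- A grid is good for the path `B` if on each interval of the partition the function
`s ↦ χ_{[-a_j, a_j]}(B_s)` is norm continuous and takes finite rank values. -/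
def Grid.IsGood (G : Grid) (B : Path x y) : Prop :=
  ∀ j : Fin G.n,
    (∀ s ∈ Set.Icc (G.t j.castSucc) (G.t j.succ),
      FiniteDimensional ℂ
        (spectralSubspace (B s : E →L[ℂ] E) (Set.Icc (-G.a j) (G.a j)))) ∧
    ContinuousOn
      (fun s : unitInterval =>
        spectralProjection (B s : E →L[ℂ] E) (Set.Icc (-G.a j) (G.a j)))
      (Set.Icc (G.t j.castSucc) (G.t j.succ))

/-- The sum `∑ⱼ [Tr (h|_{𝔼ⱼ(tⱼ)}) - Tr (h|_{𝔼ⱼ(tⱼ₋₁)})]` over a grid. -/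
def Grid.flow (G : Grid) (h : H) (B : Path x y) : ℂ :=
  ∑ j : Fin G.n,
    (spectralTrace h (B (G.t j.succ)) (G.a j) - spectralTrace h (B (G.t j.castSucc)) (G.a j))

open Classical in
/-- The `h`-equivariant spectral flow of a path: the sum over a good grid. That good grids exist
and that the sum is the same for all of them is not part of the definition. -/
def spectralFlow (h : H) (B : Path x y) : ℂ :=
  if hG : ∃ G : Grid, G.IsGood B then (Classical.choose hG).flow h B else 0

end Hilbert

end EquivariantSpectralFlow

end

noncomputable section

namespace EquivariantSpectralFlow

section Hilbert

variable {E : Type*} [NormedAddCommGroup E] [InnerProductSpace ℂ E] [CompleteSpace E]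

/-! ### Functional calculus on eigenvectors -/

omit [CompleteSpace E] in
theorem algebraMap_real_apply (r : ℝ) (v : E) :
    (algebraMap ℝ (E →L[ℂ] E) r) v = (r : ℂ) • v := by
  rw [Algebra.algebraMap_eq_smul_one]; rfl

theorem mem_spectrum_of_eigenvector {T : E →L[ℂ] E} {μ : ℝ} {v : E} (hv : v ≠ 0)
    (h : T v = (μ : ℂ) • v) : μ ∈ spectrum ℝ T := by
  rw [spectrum.mem_iff]
  intro hu
  apply hv
  refine (ContinuousLinearMap.isUnit_iff_bijective.1 hu).1 ?_
  simp [h]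

theorem cfc_apply_eigenvector {T : E →L[ℂ] E} (hT : IsSelfAdjoint T) {μ : ℝ} {v : E}
    (h : T v = (μ : ℂ) • v) {f : ℝ → ℝ} (hf : Continuous f) :
    (cfc f T) v = (f μ : ℂ) • v := by
  rcases eq_or_ne v 0 with rfl | hv
  · simp
  have hμ := mem_spectrum_of_eigenvector hv h
  rw [cfc_apply f T hT hf.continuousOn]
  have key : ∀ g : C(spectrum ℝ T, ℝ), cfcHom hT g v = (g ⟨μ, hμ⟩ : ℂ) • v := by
    intro g
    induction g using ContinuousMap.induction_on_of_compact with
    | const r =>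
      have : ContinuousMap.const (spectrum ℝ T) r = algebraMap ℝ C(spectrum ℝ T, ℝ) r := rfl
      rw [this, AlgHomClass.commutes, algebraMap_real_apply]
      rfl
    | id => rw [cfcHom_id hT, h]; rfl
    | star_id => rw [map_star, cfcHom_id hT, hT.star_eq, h]; simp
    | add f g hf hg => rw [map_add, add_apply, hf, hg]; simp [add_smul]
    | mul f g hf hg =>
      rw [map_mul, _root_.mul_apply_eq_comp, hg, map_smul, hf, smul_smul]
      simp [mul_comm]
    | frequently f hfr =>
      have hc : IsClosed {g : C(spectrum ℝ T, ℝ) | cfcHom hT g v = (g ⟨μ, hμ⟩ : ℂ) • v} := by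
        refine isClosed_eq ?_ ?_
        · exact (ContinuousLinearMap.apply ℂ E v).continuous.comp (cfcHom_continuous hT)
        · exact (Complex.continuous_ofReal.comp (continuous_eval_const (F := C(spectrum ℝ T, ℝ)) _)).smul
            continuous_const
      exact hc.closure_subset (mem_closure_iff_frequently.2 hfr)
  exact key _

theorem inner_cfc_left (T : E →L[ℂ] E) (f : ℝ → ℝ) (x y : E) :
    inner ℂ (cfc f T x) y = inner ℂ x (cfc f T y) :=
  (ContinuousLinearMap.isSelfAdjoint_iff_isSymmetric.1 (cfc_predicate f T)) x y

theorem mem_spectralSubspace_of_eigenvector {T : E →L[ℂ] E} (hT : IsSelfAdjoint T) {μ : ℝ} {v : E}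
    (h : T v = (μ : ℂ) • v) {K : Set ℝ} (hμ : μ ∈ K) : v ∈ spectralSubspace T K := by
  intro f hf h0
  rw [cfc_apply_eigenvector hT h hf, h0 μ hμ]; simp

theorem mem_orthogonal_of_eigenvector {T : E →L[ℂ] E} (hT : IsSelfAdjoint T) {μ : ℝ} {v : E}
    (h : T v = (μ : ℂ) • v) {K : Set ℝ} (hK : IsClosed K) (hne : K.Nonempty) (hμ : μ ∉ K) :
    v ∈ (spectralSubspace T K)ᗮ := by
  rw [Submodule.mem_orthogonal]
  intro x hx
  have hf : Continuous fun r : ℝ => Metric.infDist r K := Metric.continuous_infDist_pt K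
  have h1 := hx _ hf fun r hr => Metric.infDist_zero_of_mem hr
  have h2 := cfc_apply_eigenvector hT h hf
  have h3 := inner_cfc_left T (fun r : ℝ => Metric.infDist r K) x v
  rw [h1, h2, inner_zero_left, inner_smul_right] at h3
  have h4 : Metric.infDist μ K ≠ 0 := fun h0 =>
    hμ ((hK.mem_iff_infDist_zero hne).2 h0)
  exact (mul_eq_zero.1 h3.symm).resolve_left (by exact_mod_cast h4)

theorem spectralProjection_apply_of_mem {T : E →L[ℂ] E} {K : Set ℝ} {v : E}
    (h : v ∈ spectralSubspace T K) : spectralProjection T K v = v :=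
  Submodule.starProjection_eq_self_iff.2 h

theorem spectralProjection_apply_of_mem_orthogonal {T : E →L[ℂ] E} {K : Set ℝ} {v : E}
    (h : v ∈ (spectralSubspace T K)ᗮ) : spectralProjection T K v = 0 :=
  (Submodule.starProjection_apply_eq_zero_iff _).2 h

theorem spectralProjection_apply_mem (T : E →L[ℂ] E) (K : Set ℝ) (v : E) :
    spectralProjection T K v ∈ spectralSubspace T K :=
  Submodule.starProjection_apply_mem _ v

theorem isStarProjection_spectralProjection (T : E →L[ℂ] E) (K : Set ℝ) :
    IsStarProjection (spectralProjection T K) :=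
  isStarProjection_starProjection

theorem range_spectralProjection (T : E →L[ℂ] E) (K : Set ℝ) :
    (spectralProjection T K : E →ₗ[ℂ] E).range = spectralSubspace T K :=
  Submodule.range_starProjection _

theorem spectralSubspace_mono (T : E →L[ℂ] E) {K L : Set ℝ} (h : K ⊆ L) :
    spectralSubspace T K ≤ spectralSubspace T L :=
  fun _ hx f hf h0 => hx f hf fun r hr => h0 r (h hr)

/-- Spectral projections commute with all operators commuting with the operator. -/
theorem commute_spectralProjection {T U : E →L[ℂ] E} (hT : IsSelfAdjoint T) (hU : Commute T U)
    (K : Set ℝ) : Commute (spectralProjection T K) U := by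
  have hU' : Commute T (star U) := by
    have := hU.star_star
    rwa [hT.star_eq] at this
  ext x
  change spectralProjection T K (U x) = U (spectralProjection T K x)
  refine Submodule.eq_starProjection_of_mem_of_inner_eq_zero
    (mem_spectralSubspace_of_commute hU K _ (spectralProjection_apply_mem T K x)) fun w hw => ?_
  rw [← map_sub, ← ContinuousLinearMap.adjoint_inner_right]
  exact Submodule.starProjection_inner_eq_zero _ _
    (mem_spectralSubspace_of_commute hU' K w hw)

/-- A continuous function that is the indicator function of `K` on the spectrum computes the
spectral projection. -/
theorem spectralProjection_eq_cfc {T : E →L[ℂ] E} (hT : IsSelfAdjoint T) {K : Set ℝ} {f : ℝ → ℝ}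
    (hf : Continuous f) (h1 : ∀ r ∈ K, f r = 1) (h0 : ∀ r ∈ spectrum ℝ T, r ∉ K → f r = 0) :
    spectralProjection T K = cfc f T := by
  ext x
  have hone : ∀ y ∈ spectralSubspace T K, cfc f T y = y := by
    intro y hy
    have := hy (fun r => 1 - f r) (by fun_prop) fun r hr => by simp [h1 r hr]
    rw [cfc_sub (fun _ : ℝ => (1 : ℝ)) f T, cfc_const_one ℝ T, sub_apply,
      sub_eq_zero] at this
    exact this.symm
  refine Submodule.eq_starProjection_of_mem_of_inner_eq_zero ?_ fun w hw => ?_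
  · intro g hg hg0
    rw [← _root_.mul_apply_eq_comp, ← cfc_mul g f T,
      cfc_congr (g := fun _ => (0 : ℝ)), cfc_const_zero]
    · rfl
    · intro r hr
      by_cases hrK : r ∈ K
      · simp [hg0 r hrK]
      · simp [h0 r hr hrK]
  · rw [inner_sub_left, inner_cfc_left, hone w hw, sub_self]

/-- Two operators agree if they agree on the eigenvectors in a finite dimensional spectral subspace
and on its orthogonal complement. -/
theorem ext_of_eigenvectors {T A B : E →L[ℂ] E} (hT : IsSelfAdjoint T) {K : Set ℝ}
    [FiniteDimensional ℂ (spectralSubspace T K)]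
    (h1 : ∀ (μ : ℝ) (v : E), v ∈ spectralSubspace T K → T v = (μ : ℂ) • v → A v = B v)
    (h2 : ∀ v ∈ (spectralSubspace T K)ᗮ, A v = B v) : A = B := by
  have hinv : ∀ x ∈ spectralSubspace T K, T x ∈ spectralSubspace T K :=
    mem_spectralSubspace_of_commute (Commute.refl T) K
  have hsym : ((T : E →ₗ[ℂ] E).restrict hinv).IsSymmetric :=
    (ContinuousLinearMap.isSelfAdjoint_iff_isSymmetric.1 hT).restrict_invariant hinv
  have hV : ∀ v : spectralSubspace T K, A v = B v := by
    intro v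
    set b := hsym.eigenvectorBasis rfl
    rw [← b.sum_repr v]
    simp only [Submodule.coe_sum, Submodule.coe_smul, map_sum, map_smul]
    refine Finset.sum_congr rfl fun i _ => ?_
    congr 1
    refine h1 (hsym.eigenvalues rfl i) _ (b i).2 ?_
    exact congrArg Subtype.val (hsym.apply_eigenvectorBasis rfl i)
  ext x
  rw [← Submodule.starProjection_add_starProjection_orthogonal (K := spectralSubspace T K) x, map_add,
    map_add, h2 _ (Submodule.starProjection_apply_mem _ x)]
  rw [hV ⟨_, Submodule.starProjection_apply_mem _ x⟩]

/-- The difference of two spectral projections on nonnegative intervals is a continuous function of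
the truncation of the operator to the corresponding difference of symmetric windows. -/
theorem spectralProjection_Icc_sub {T : E →L[ℂ] E} (hT : IsSelfAdjoint T) {a b : ℝ} (ha : 0 < a)
    (hab : a ≤ b) [FiniteDimensional ℂ (spectralSubspace T (Set.Icc (-b) b))] :
    spectralProjection T (Set.Icc 0 b) - spectralProjection T (Set.Icc 0 a) =
      cfc (fun r : ℝ => max 0 (min 1 (r / a)))
        (T * (spectralProjection T (Set.Icc (-b) b) - spectralProjection T (Set.Icc (-a) a))) := by
  have hf : Continuous fun r : ℝ => max 0 (min 1 (r / a)) := by fun_prop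
  have hA : IsSelfAdjoint
      (T * (spectralProjection T (Set.Icc (-b) b) - spectralProjection T (Set.Icc (-a) a))) := by
    have hc : ∀ K, Commute T (spectralProjection T K) := fun K =>
      (commute_spectralProjection hT (Commute.refl T) K).symm
    exact (hT.commute_iff ((isStarProjection_spectralProjection T _).isSelfAdjoint.sub
      (isStarProjection_spectralProjection T _).isSelfAdjoint)).1 ((hc _).sub_right (hc _))
  refine ext_of_eigenvectors hT (K := Set.Icc (-b) b) (fun μ v hv h => ?_) fun v hv => ?_
  · rcases eq_or_ne v 0 with rfl | hv0
    · simp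
    have hproj : ∀ K : Set ℝ, IsClosed K → K.Nonempty → μ ∉ K → spectralProjection T K v = 0 :=
      fun K hK hn hμ =>
        spectralProjection_apply_of_mem_orthogonal (mem_orthogonal_of_eigenvector hT h hK hn hμ)
    have hproj' : ∀ K : Set ℝ, μ ∈ K → spectralProjection T K v = v :=
      fun K hμ => spectralProjection_apply_of_mem (mem_spectralSubspace_of_eigenvector hT h hμ)
    have hμb : μ ∈ Set.Icc (-b) b := by
      by_contra hμ
      exact hv0 ((spectralProjection_apply_of_mem hv).symm.trans
        (hproj _ isClosed_Icc ⟨0, by constructor <;> linarith⟩ hμ))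
    by_cases hμa : μ ∈ Set.Icc (-a) a
    · have hA0 : (T * (spectralProjection T (Set.Icc (-b) b) -
          spectralProjection T (Set.Icc (-a) a))) v = ((0 : ℝ) : ℂ) • v := by
        simp [hproj' _ hμb, hproj' _ hμa]
      rw [cfc_apply_eigenvector hA hA0 hf]
      by_cases h0 : 0 ≤ μ
      · simp [hproj' (Set.Icc 0 b) ⟨h0, hμb.2⟩, hproj' (Set.Icc 0 a) ⟨h0, hμa.2⟩]
      · simp [hproj (Set.Icc 0 b) isClosed_Icc ⟨0, by constructor <;> linarith⟩ fun h => h0 h.1,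
          hproj (Set.Icc 0 a) isClosed_Icc ⟨0, by constructor <;> linarith⟩ fun h => h0 h.1]
    · have hA0 : (T * (spectralProjection T (Set.Icc (-b) b) -
          spectralProjection T (Set.Icc (-a) a))) v = (μ : ℂ) • v := by
        simp [hproj' _ hμb, hproj _ isClosed_Icc ⟨0, by constructor <;> linarith⟩ hμa, h]
      rw [cfc_apply_eigenvector hA hA0 hf]
      by_cases h0 : 0 ≤ μ
      · have hlt : a < μ := by
          by_contra hle
          exact hμa ⟨by linarith, not_lt.1 hle⟩
        have h1 : 1 ≤ μ / a := (one_le_div ha).2 hlt.le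
        simp [hproj' (Set.Icc 0 b) ⟨h0, hμb.2⟩,
          hproj (Set.Icc 0 a) isClosed_Icc ⟨0, by constructor <;> linarith⟩
            fun h => not_lt.2 h.2 hlt, h1]
      · have h1 : min 1 (μ / a) ≤ 0 :=
          (min_le_right _ _).trans (div_nonpos_of_nonpos_of_nonneg (not_le.1 h0).le ha.le)
        simp [hproj (Set.Icc 0 b) isClosed_Icc ⟨0, by constructor <;> linarith⟩ fun h => h0 h.1,
          hproj (Set.Icc 0 a) isClosed_Icc ⟨0, by constructor <;> linarith⟩ fun h => h0 h.1, h1]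
  · have hproj : ∀ K : Set ℝ, K ⊆ Set.Icc (-b) b → spectralProjection T K v = 0 := fun K hK =>
      spectralProjection_apply_of_mem_orthogonal
        (Submodule.orthogonal_le (spectralSubspace_mono T hK) hv)
    have hA0 : (T * (spectralProjection T (Set.Icc (-b) b) -
        spectralProjection T (Set.Icc (-a) a))) v = ((0 : ℝ) : ℂ) • v := by
      simp [hproj _ subset_rfl, hproj _ (Set.Icc_subset_Icc (neg_le_neg hab) hab)]
    rw [cfc_apply_eigenvector hA hA0 hf]
    simp [hproj _ (Set.Icc_subset_Icc (by linarith : -b ≤ 0) le_rfl),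
      hproj _ (Set.Icc_subset_Icc (by linarith : -b ≤ 0) hab)]

end Hilbert

/-! ### Traces of finite rank operators -/

section Trace

variable {V : Type*} [AddCommGroup V] [Module ℂ V]

/-- The trace of a finite rank operator, computed on its range. -/
def finrankTrace (A : V →ₗ[ℂ] V) : ℂ :=
  LinearMap.trace ℂ A.range (A.restrict fun x _ => LinearMap.mem_range_self A x)

theorem trace_restrict_eq_finrankTrace (A : V →ₗ[ℂ] V) (W : Submodule ℂ V) [FiniteDimensional ℂ W]
    (hA : ∀ x, A x ∈ W) :
    LinearMap.trace ℂ W (A.restrict fun x _ => hA x) = finrankTrace A := by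
  have hle : A.range ≤ W := by rintro _ ⟨x, rfl⟩; exact hA x
  have : FiniteDimensional ℂ A.range := Submodule.finiteDimensional_of_le hle
  exact LinearMap.trace_comp_comm' (A.rangeRestrict ∘ₗ W.subtype) (Submodule.inclusion hle)

theorem finrankTrace_sub (A B : V →ₗ[ℂ] V) [FiniteDimensional ℂ A.range]
    [FiniteDimensional ℂ B.range] :
    finrankTrace (A - B) = finrankTrace A - finrankTrace B := by
  have hA : ∀ x, A x ∈ A.range ⊔ B.range := fun x => Submodule.mem_sup_left ⟨x, rfl⟩
  have hB : ∀ x, B x ∈ A.range ⊔ B.range := fun x => Submodule.mem_sup_right ⟨x, rfl⟩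
  rw [← trace_restrict_eq_finrankTrace A _ hA, ← trace_restrict_eq_finrankTrace B _ hB,
    ← trace_restrict_eq_finrankTrace (A - B) (A.range ⊔ B.range)
      (fun x => Submodule.sub_mem _ (hA x) (hB x)), ← map_sub]
  rfl

theorem finrankTrace_conj {A B : V →ₗ[ℂ] V} [FiniteDimensional ℂ A.range] (e : V ≃ₗ[ℂ] V)
    (h : ∀ x, e (A x) = B (e x)) : finrankTrace B = finrankTrace A := by
  have hB : ∀ x, B x ∈ A.range.map (e : V →ₗ[ℂ] V) := fun x =>
    ⟨A (e.symm x), ⟨_, rfl⟩, by simp [h]⟩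
  rw [← trace_restrict_eq_finrankTrace B _ hB, finrankTrace,
    ← LinearMap.trace_conj' _ (e.submoduleMap A.range)]
  congr 1
  ext x
  obtain ⟨y, hy⟩ := (e.submoduleMap A.range).surjective x
  subst hy
  simp [LinearEquiv.conj_apply, h]

end Trace

section Hilbert

variable {E : Type*} [NormedAddCommGroup E] [InnerProductSpace ℂ E] [CompleteSpace E]

/-- Idempotents at distance less than `1/2` are intertwined by an invertible operator that commutes
with everything commuting with both. -/
theorem exists_intertwiner_of_norm_sub_lt {P Q : E →L[ℂ] E} (hP : IsIdempotentElem P)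
    (hQ : IsIdempotentElem Q) (hPQ : ‖P‖ ≤ 1) (hQP : ‖Q‖ ≤ 1) (h : ‖Q - P‖ < 1 / 2) :
    ∃ Z : (E →L[ℂ] E)ˣ, (Z : E →L[ℂ] E) * P = Q * Z ∧
      ∀ U : E →L[ℂ] E, Commute P U → Commute Q U → Commute (Z : E →L[ℂ] E) U := by
  have hlt : ‖Q * (Q - P) + (P - Q) * P‖ < 1 := by
    have h1 : ‖Q * (Q - P)‖ ≤ 1 * ‖Q - P‖ :=
      (norm_mul_le _ _).trans (mul_le_mul_of_nonneg_right hQP (norm_nonneg _))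
    have h2 : ‖(P - Q) * P‖ ≤ ‖Q - P‖ * 1 := by
      rw [← norm_neg (Q - P), neg_sub]
      exact (norm_mul_le _ _).trans (mul_le_mul_of_nonneg_left hPQ (norm_nonneg _))
    linarith [norm_add_le (Q * (Q - P)) ((P - Q) * P)]
  have hZ : ((Units.oneSub _ hlt : (E →L[ℂ] E)ˣ) : E →L[ℂ] E) = Q * P + (1 - Q) * (1 - P) := by
    rw [Units.val_oneSub]
    have hP' : P * P = P := hP
    have hQ' : Q * Q = Q := hQ
    simp only [mul_sub, sub_mul, one_mul, mul_one, hP', hQ']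
    abel
  refine ⟨Units.oneSub _ hlt, ?_, fun U hPU hQU => ?_⟩
  · rw [hZ]
    have hP' : P * P = P := hP
    have hQ' : Q * Q = Q := hQ
    simp only [mul_sub, sub_mul, one_mul, mul_one, mul_add, add_mul, mul_assoc, hP']
    simp only [← mul_assoc, hQ']
    abel
  · rw [hZ]
    exact (hQU.mul_left hPU).add_left
      (((Commute.one_left U).sub_left hQU).mul_left ((Commute.one_left U).sub_left hPU))

omit [CompleteSpace E] in
theorem finiteDimensional_range_mul (U Q : E →L[ℂ] E) [FiniteDimensional ℂ (Q : E →ₗ[ℂ] E).range] :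
    FiniteDimensional ℂ ((U * Q : E →L[ℂ] E) : E →ₗ[ℂ] E).range := by
  have : ((U * Q : E →L[ℂ] E) : E →ₗ[ℂ] E).range =
      (Q : E →ₗ[ℂ] E).range.map (U : E →ₗ[ℂ] E) := LinearMap.range_comp _ _
  rw [this]
  infer_instance

theorem finrankTrace_mul_eq_of_norm_sub_lt {P Q U : E →L[ℂ] E} (hP : IsStarProjection P)
    (hQ : IsStarProjection Q) (h : ‖Q - P‖ < 1 / 2) (hPU : Commute P U) (hQU : Commute Q U)
    [FiniteDimensional ℂ (P : E →ₗ[ℂ] E).range] :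
    finrankTrace ((U * Q : E →L[ℂ] E) : E →ₗ[ℂ] E) =
      finrankTrace ((U * P : E →L[ℂ] E) : E →ₗ[ℂ] E) := by
  obtain ⟨Z, hZ, hZU⟩ := exists_intertwiner_of_norm_sub_lt hP.isIdempotentElem
    hQ.isIdempotentElem hP.norm_le hQ.norm_le h
  have := finiteDimensional_range_mul U P
  refine finrankTrace_conj (ContinuousLinearEquiv.ofUnit Z).toLinearEquiv fun x => ?_
  have h1 : (Z : E →L[ℂ] E) * (U * P) = U * Q * Z := by
    rw [← mul_assoc, (hZU U hPU hQU).eq, mul_assoc, hZ, mul_assoc]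
  exact congrArg (fun A : E →L[ℂ] E => A x) h1

theorem finrankTrace_mul_eq_of_isPreconnected {Y : Type*} [TopologicalSpace Y] {S : Set Y}
    (hS : IsPreconnected S) {Q : Y → E →L[ℂ] E} (hQ : ContinuousOn Q S) {U : E →L[ℂ] E}
    (hproj : ∀ s ∈ S, IsStarProjection (Q s)) (hU : ∀ s ∈ S, Commute (Q s) U)
    (hfin : ∀ s ∈ S, FiniteDimensional ℂ (Q s : E →ₗ[ℂ] E).range) {s t : Y} (hs : s ∈ S)
    (ht : t ∈ S) :
    finrankTrace ((U * Q s : E →L[ℂ] E) : E →ₗ[ℂ] E) =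
      finrankTrace ((U * Q t : E →L[ℂ] E) : E →ₗ[ℂ] E) := by
  refine hS.induction₂ (fun s t => finrankTrace ((U * Q s : E →L[ℂ] E) : E →ₗ[ℂ] E) =
      finrankTrace ((U * Q t : E →L[ℂ] E) : E →ₗ[ℂ] E)) (fun x hx => ?_)
      (fun _ _ _ _ _ _ => Eq.trans) (fun _ _ _ _ => Eq.symm) hs ht
  have h1 : ∀ᶠ y in nhdsWithin x S, ‖Q y - Q x‖ < 1 / 2 := by
    have := Metric.continuousWithinAt_iff'.1 (hQ x hx) (1 / 2) (by norm_num)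
    simpa only [dist_eq_norm] using this
  filter_upwards [h1, self_mem_nhdsWithin] with y hy hyS
  have := hfin x hx
  exact (finrankTrace_mul_eq_of_norm_sub_lt (hproj x hx) (hproj y hyS) hy (hU x hx)
    (hU y hyS)).symm

variable {H : Type*} [Group H] {ρ : H →* (E →L[ℂ] E)}

theorem spectralTrace_eq_finrankTrace (h : H) (T : saFredholm ρ) (a : ℝ)
    [FiniteDimensional ℂ (spectralSubspace (T : E →L[ℂ] E) (Set.Icc 0 a))] :
    spectralTrace h T a = finrankTrace
      ((ρ h * spectralProjection (T : E →L[ℂ] E) (Set.Icc 0 a) : E →L[ℂ] E) : E →ₗ[ℂ] E) := by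
  rw [← trace_restrict_eq_finrankTrace ((ρ h * spectralProjection (T : E →L[ℂ] E) (Set.Icc 0 a) :
      E →L[ℂ] E) : E →ₗ[ℂ] E) (spectralSubspace (T : E →L[ℂ] E) (Set.Icc 0 a))
    (fun x => mem_spectralSubspace_of_commute (T.2.2.2 h) _ _ (spectralProjection_apply_mem _ _ x))]
  rw [spectralTrace]
  congr 1
  ext x
  exact congrArg (ρ h) (spectralProjection_apply_of_mem x.2).symm

/-- The window `[-a, a]` is admissible on `S` for a family of operators: the spectral projections
have finite rank and depend continuously on the parameter. -/
def IsWindow {Y : Type*} [TopologicalSpace Y] (T : Y → saFredholm ρ) (S : Set Y) (a : ℝ) : Prop :=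
  (∀ s ∈ S, FiniteDimensional ℂ (spectralSubspace (T s : E →L[ℂ] E) (Set.Icc (-a) a))) ∧
    ContinuousOn (fun s => spectralProjection (T s : E →L[ℂ] E) (Set.Icc (-a) a)) S

theorem IsWindow.mono {Y : Type*} [TopologicalSpace Y] {T : Y → saFredholm ρ} {S S' : Set Y}
    {a : ℝ} (h : IsWindow T S a) (hS : S' ⊆ S) : IsWindow T S' a :=
  ⟨fun s hs => h.1 s (hS hs), h.2.mono hS⟩

theorem IsWindow.comp {Y X : Type*} [TopologicalSpace Y] [TopologicalSpace X] {T : X → saFredholm ρ}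
    {S : Set X} {a : ℝ} (h : IsWindow T S a) {g : Y → X} (hg : Continuous g) {S' : Set Y}
    (hS : Set.MapsTo g S' S) : IsWindow (fun y => T (g y)) S' a :=
  ⟨fun _ hs => h.1 _ (hS hs), h.2.comp hg.continuousOn hS⟩

theorem IsWindow.spectralTrace_sub_eq_of_le {Y : Type*} [TopologicalSpace Y] {T : Y → saFredholm ρ}
    {S : Set Y} {a b : ℝ} (hT : ContinuousOn T S) (hS : IsPreconnected S) (ha0 : 0 < a)
    (hab : a ≤ b) (ha : IsWindow T S a) (hb : IsWindow T S b) (h : H) {s t : Y} (hs : s ∈ S)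
    (ht : t ∈ S) :
    spectralTrace h (T s) b - spectralTrace h (T s) a =
      spectralTrace h (T t) b - spectralTrace h (T t) a := by
  set Q : Y → E →L[ℂ] E := fun s => spectralProjection (T s : E →L[ℂ] E) (Set.Icc 0 b) -
    spectralProjection (T s : E →L[ℂ] E) (Set.Icc 0 a) with hQ
  have hfin : ∀ s ∈ S, ∀ c ≤ b,
      FiniteDimensional ℂ (spectralSubspace (T s : E →L[ℂ] E) (Set.Icc 0 c)) := by
    intro s hs c hc
    have := hb.1 s hs
    exact Submodule.finiteDimensional_of_le
      (spectralSubspace_mono _ (Set.Icc_subset_Icc (by linarith : -b ≤ 0) hc))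
  have hfin' : ∀ s ∈ S, ∀ c ≤ b, FiniteDimensional ℂ
      (spectralProjection (T s : E →L[ℂ] E) (Set.Icc 0 c) : E →ₗ[ℂ] E).range := by
    intro _ hs c hc
    rw [range_spectralProjection]
    exact hfin _ hs c hc
  have htr : ∀ s ∈ S, spectralTrace h (T s) b - spectralTrace h (T s) a =
      finrankTrace ((ρ h * Q s : E →L[ℂ] E) : E →ₗ[ℂ] E) := by
    intro s hs
    have := hfin s hs a hab
    have := hfin s hs b le_rfl
    have := hfin' s hs a hab
    have := hfin' s hs b le_rfl
    have := finiteDimensional_range_mul (ρ h) (spectralProjection (T s : E →L[ℂ] E) (Set.Icc 0 a))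
    have := finiteDimensional_range_mul (ρ h) (spectralProjection (T s : E →L[ℂ] E) (Set.Icc 0 b))
    rw [spectralTrace_eq_finrankTrace, spectralTrace_eq_finrankTrace, ← finrankTrace_sub, hQ,
      mul_sub]
    rfl
  rw [htr s hs, htr t ht]
  refine finrankTrace_mul_eq_of_isPreconnected hS ?_ (fun s hs => ?_) (fun s hs => ?_)
    (fun s hs => ?_) hs ht
  · have hc : ContinuousOn (fun s => cfc (fun r : ℝ => max 0 (min 1 (r / a)))
        ((T s : E →L[ℂ] E) * (spectralProjection (T s : E →L[ℂ] E) (Set.Icc (-b) b) -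
          spectralProjection (T s : E →L[ℂ] E) (Set.Icc (-a) a)))) S := by
      refine ContinuousOn.cfc_of_mem_nhdsSet (s := Set.univ) _ Filter.univ_mem
        ((continuous_subtype_val.comp_continuousOn hT).mul (hb.2.sub ha.2)) (fun s hs => ?_)
        (by fun_prop)
      have hsa := (T s).2.1
      have hcm : ∀ K, Commute (T s : E →L[ℂ] E) (spectralProjection (T s : E →L[ℂ] E) K) :=
        fun K => (commute_spectralProjection hsa (Commute.refl _) K).symm
      exact (hsa.commute_iff ((isStarProjection_spectralProjection _ _).isSelfAdjoint.sub
        (isStarProjection_spectralProjection _ _).isSelfAdjoint)).1 ((hcm _).sub_right (hcm _))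
    refine hc.congr fun s hs => ?_
    have := hb.1 s hs
    exact spectralProjection_Icc_sub (T s).2.1 ha0 hab
  · refine IsStarProjection.sub_of_mul_eq_right (isStarProjection_spectralProjection _ _)
      (isStarProjection_spectralProjection _ _) ?_
    ext x
    exact spectralProjection_apply_of_mem (spectralSubspace_mono _ (Set.Icc_subset_Icc_right hab)
      (spectralProjection_apply_mem _ _ x))
  · exact (commute_spectralProjection (T s).2.1 ((T s).2.2.2 h) _).sub_left
      (commute_spectralProjection (T s).2.1 ((T s).2.2.2 h) _)
  · have := hfin' s hs a hab
    have := hfin' s hs b le_rfl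
    refine Submodule.finiteDimensional_of_le (S₂ :=
      (spectralProjection (T s : E →L[ℂ] E) (Set.Icc 0 b) : E →ₗ[ℂ] E).range ⊔
      (spectralProjection (T s : E →L[ℂ] E) (Set.Icc 0 a) : E →ₗ[ℂ] E).range) ?_
    rintro _ ⟨x, rfl⟩
    exact Submodule.sub_mem _ (Submodule.mem_sup_left ⟨x, rfl⟩) (Submodule.mem_sup_right ⟨x, rfl⟩)

/-- The change of the spectral trace does not depend on the admissible window. -/
theorem IsWindow.spectralTrace_sub_eq {Y : Type*} [TopologicalSpace Y] {T : Y → saFredholm ρ}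
    {S : Set Y} {a b : ℝ} (hT : ContinuousOn T S) (hS : IsPreconnected S) (ha0 : 0 < a)
    (hb0 : 0 < b) (ha : IsWindow T S a) (hb : IsWindow T S b) (h : H) {s t : Y} (hs : s ∈ S)
    (ht : t ∈ S) :
    spectralTrace h (T t) a - spectralTrace h (T s) a =
      spectralTrace h (T t) b - spectralTrace h (T s) b := by
  rcases le_total a b with hab | hab
  · linear_combination IsWindow.spectralTrace_sub_eq_of_le hT hS ha0 hab ha hb h hs ht
  · linear_combination -IsWindow.spectralTrace_sub_eq_of_le hT hS hb0 hab hb ha h hs ht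

end Hilbert

section Hilbert

variable {E : Type*} [NormedAddCommGroup E] [InnerProductSpace ℂ E] [CompleteSpace E]

/-! ### Local existence of admissible windows -/

/-- The orthogonal projection onto the kernel of an operator. -/
def kerProjection (T : E →L[ℂ] E) : E →L[ℂ] E :=
  have : CompleteSpace (T : E →ₗ[ℂ] E).ker := T.isClosed_ker.completeSpace_coe
  (T : E →ₗ[ℂ] E).ker.starProjection

theorem apply_kerProjection (T : E →L[ℂ] E) (x : E) : T (kerProjection T x) = 0 := by
  have : CompleteSpace (T : E →ₗ[ℂ] E).ker := T.isClosed_ker.completeSpace_coe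
  exact Submodule.starProjection_apply_mem (T : E →ₗ[ℂ] E).ker x

theorem kerProjection_apply_of_apply_eq_zero {T : E →L[ℂ] E} {x : E} (h : T x = 0) :
    kerProjection T x = x := by
  have : CompleteSpace (T : E →ₗ[ℂ] E).ker := T.isClosed_ker.completeSpace_coe
  exact (Submodule.starProjection_eq_self_iff (K := (T : E →ₗ[ℂ] E).ker)).2 h

theorem kerProjection_apply_apply {T : E →L[ℂ] E} (hT : IsSelfAdjoint T) (x : E) :
    kerProjection T (T x) = 0 := by
  have : CompleteSpace (T : E →ₗ[ℂ] E).ker := T.isClosed_ker.completeSpace_coe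
  refine (Submodule.starProjection_apply_eq_zero_iff (T : E →ₗ[ℂ] E).ker).2 ?_
  rw [Submodule.mem_orthogonal]
  intro k hk
  have h1 : inner ℂ (T k) x = inner ℂ k (T x) :=
    ContinuousLinearMap.isSelfAdjoint_iff_isSymmetric.1 hT k x
  have hk' : T k = 0 := hk
  rw [← h1, hk', inner_zero_left]

theorem inner_sub_kerProjection {T : E →L[ℂ] E} {k : E} (hk : T k = 0) (y : E) :
    inner ℂ k (y - kerProjection T y) = 0 := by
  have : CompleteSpace (T : E →ₗ[ℂ] E).ker := T.isClosed_ker.completeSpace_coe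
  exact (Submodule.mem_orthogonal _ _).1
    (Submodule.sub_starProjection_mem_orthogonal (K := (T : E →ₗ[ℂ] E).ker) y) k hk

theorem sub_kerProjection_mem_range {T : E →L[ℂ] E} (hT : IsSelfAdjoint T) (hF : T.IsFredholm)
    (y : E) : ∃ z, T z = y - kerProjection T y := by
  have hcl : IsClosed ((T : E →ₗ[ℂ] E).range : Set E) := hF.isClosed_range
  have : CompleteSpace (T : E →ₗ[ℂ] E).range := hcl.completeSpace_coe
  change y - kerProjection T y ∈ (T : E →ₗ[ℂ] E).range
  rw [← Submodule.orthogonal_orthogonal (T : E →ₗ[ℂ] E).range, Submodule.mem_orthogonal]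
  intro k hk
  rw [ContinuousLinearMap.orthogonal_range] at hk
  have hk' : T k = 0 := by
    have : star T k = 0 := hk
    rwa [hT.star_eq] at this
  exact inner_sub_kerProjection hk' y

/-- A self-adjoint Fredholm operator becomes invertible after adding the projection onto its
kernel. -/
theorem isUnit_add_kerProjection {T : E →L[ℂ] E} (hT : IsSelfAdjoint T) (hF : T.IsFredholm) :
    IsUnit (T + kerProjection T) := by
  have hK := fun x => kerProjection_apply_of_apply_eq_zero (apply_kerProjection T x)
  refine ContinuousLinearMap.isUnit_iff_bijective.2 ⟨?_, fun y => ?_⟩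
  · refine (injective_iff_map_eq_zero (T + kerProjection T)).2 fun x hx => ?_
    have hx' : T x + kerProjection T x = 0 := hx
    have h1 : kerProjection T x = 0 := by
      have := congrArg (kerProjection T) hx'
      rwa [map_add, kerProjection_apply_apply hT, hK, zero_add, map_zero] at this
    rw [h1, add_zero] at hx'
    rw [← kerProjection_apply_of_apply_eq_zero hx', h1]
  · obtain ⟨z, hz⟩ := sub_kerProjection_mem_range hT hF y
    refine ⟨kerProjection T y + (z - kerProjection T z), ?_⟩
    rw [add_apply]
    simp only [map_add, map_sub, apply_kerProjection, hz, hK]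
    abel

/-- The number `0` is not an accumulation point of the spectrum of a self-adjoint Fredholm
operator. -/
theorem exists_spectral_gap {T : E →L[ℂ] E} (hT : IsSelfAdjoint T) (hF : T.IsFredholm) :
    ∃ δ > 0, ∀ r ∈ spectrum ℝ T, |r| < δ → r = 0 := by
  have h0 : (0 : ℝ) ∉ spectrum ℝ (T + kerProjection T) :=
    spectrum.zero_notMem ℝ (isUnit_add_kerProjection hT hF)
  obtain ⟨ε, hε, hball⟩ := Metric.isOpen_iff.1
    (spectrum.isClosed (𝕜 := ℝ) (T + kerProjection T)).isOpen_compl 0 h0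
  refine ⟨min ε 1, by positivity, fun r hr hlt => ?_⟩
  by_contra hr0
  refine (spectrum.mem_iff.1 hr) ?_
  have hrC : (r : ℂ) ≠ 0 := by exact_mod_cast hr0
  have hr1 : (r : ℂ) - 1 ≠ 0 := by
    rw [sub_ne_zero]
    intro h
    have h' : r = 1 := by exact_mod_cast h
    rw [h'] at hlt
    simp at hlt
  have hunit : IsUnit (algebraMap ℝ (E →L[ℂ] E) r - (T + kerProjection T)) := by
    have : r ∉ spectrum ℝ (T + kerProjection T) := hball (by
      simpa [Real.norm_eq_abs] using hlt.trans_le (min_le_left _ _))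
    rwa [spectrum.notMem_iff] at this
  have hbij := ContinuousLinearMap.isUnit_iff_bijective.1 hunit
  have happ : ∀ x, (algebraMap ℝ (E →L[ℂ] E) r - (T + kerProjection T)) x =
      (r : ℂ) • x - (T x + kerProjection T x) := fun x => by
    rw [sub_apply, algebraMap_real_apply, add_apply]
  have happ' : ∀ x, (algebraMap ℝ (E →L[ℂ] E) r - T) x = (r : ℂ) • x - T x := fun x => by
    rw [sub_apply, algebraMap_real_apply]
  have hK := fun x => kerProjection_apply_of_apply_eq_zero (apply_kerProjection T x)
  refine ContinuousLinearMap.isUnit_iff_bijective.2 ⟨?_, fun y => ?_⟩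
  · refine (injective_iff_map_eq_zero (algebraMap ℝ (E →L[ℂ] E) r - T)).2 fun x hx => ?_
    rw [happ'] at hx
    have hPx : kerProjection T x = 0 := by
      have := congrArg (kerProjection T) hx
      rw [map_sub, map_smul, kerProjection_apply_apply hT, sub_zero, map_zero] at this
      exact (smul_eq_zero.1 this).resolve_left hrC
    refine (injective_iff_map_eq_zero _).1 hbij.1 x ?_
    rw [happ, hPx, add_zero, hx]
  · obtain ⟨x, hx⟩ := hbij.2 (y - kerProjection T y)
    rw [happ] at hx
    have hPx : kerProjection T x = 0 := by
      have := congrArg (kerProjection T) hx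
      rw [map_sub, map_smul, map_add, kerProjection_apply_apply hT, hK, map_sub, hK, zero_add,
        sub_self] at this
      have h2 : ((r : ℂ) - 1) • kerProjection T x = 0 := by rw [sub_smul, one_smul, this]
      exact (smul_eq_zero.1 h2).resolve_left hr1
    refine ⟨x + (r : ℂ)⁻¹ • kerProjection T y, ?_⟩
    rw [hPx, add_zero] at hx
    rw [happ', map_add, map_smul, apply_kerProjection, smul_zero, add_zero, smul_add, smul_smul,
      mul_inv_cancel₀ hrC, one_smul, add_sub_right_comm, hx, sub_add_cancel]

theorem spectralSubspace_le_ker {T : E →L[ℂ] E} (hT : IsSelfAdjoint T) {a : ℝ} (ha : 0 < a)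
    (hgap : ∀ r ∈ spectrum ℝ T, |r| < 2 * a → r = 0) :
    spectralSubspace T (Set.Icc (-a) a) ≤ (T : E →ₗ[ℂ] E).ker := by
  intro x hx
  have h := hx (fun r => r * max 0 (min 1 (|r| / a - 1))) (by fun_prop) fun r hr => by
    have h1 : |r| / a - 1 ≤ 0 := sub_nonpos.2 ((div_le_one ha).2 (abs_le.2 hr))
    rw [max_eq_left ((min_le_right _ _).trans h1), mul_zero]
  rw [cfc_congr (g := id), cfc_id ℝ T] at h
  · exact h
  · intro r hr
    by_cases hlt : |r| < 2 * a
    · simp [hgap r hr hlt]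
    · have h1 : 1 ≤ |r| / a - 1 := by
        have : 2 ≤ |r| / a := (le_div_iff₀ ha).2 (not_lt.1 hlt)
        linarith
      simp [h1]

omit [CompleteSpace E] in
/-- Projections at distance less than `1` have finite rank simultaneously. -/
theorem finiteDimensional_of_norm_starProjection_sub_lt {V W : Submodule ℂ E}
    [V.HasOrthogonalProjection] [W.HasOrthogonalProjection] [FiniteDimensional ℂ V]
    (h : ‖W.starProjection - V.starProjection‖ < 1) : FiniteDimensional ℂ W := by
  let f : W →ₗ[ℂ] V := (V.orthogonalProjectionOnto : E →ₗ[ℂ] V) ∘ₗ W.subtype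
  refine Module.Finite.of_injective f ((injective_iff_map_eq_zero f).2 fun x hx => ?_)
  have hV : V.starProjection (x : E) = 0 := congrArg Subtype.val hx
  have hW : W.starProjection (x : E) = x := Submodule.starProjection_eq_self_iff.2 x.2
  have hle := (W.starProjection - V.starProjection).le_opNorm (x : E)
  rw [sub_apply, hV, hW, sub_zero] at hle
  by_contra hne
  have : 0 < ‖(x : E)‖ := norm_pos_iff.2 fun h0 => hne (Subtype.ext h0)
  nlinarith

variable {H : Type*} [Group H] {ρ : H →* (E →L[ℂ] E)}

theorem exists_isWindow (T : saFredholm ρ) :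
    ∃ a > 0, ∃ U : Set (saFredholm ρ), IsOpen U ∧ T ∈ U ∧ IsWindow (fun S => S) U a := by
  obtain ⟨δ, hδ, hgap⟩ := exists_spectral_gap T.2.1 T.2.2.1
  obtain ⟨a, ha, rfl⟩ : ∃ a > 0, δ = 2 * a := ⟨δ / 2, by positivity, by ring⟩
  set f : ℝ → ℝ := fun r => max 0 (min 1 (3 - 2 * (|r| / a))) with hf
  have hfc : Continuous f := by fun_prop
  have hopen : IsOpen {r : ℝ | |r| < a ∨ 3 * a < 2 * |r|} :=
    (isOpen_lt continuous_abs continuous_const).union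
      (isOpen_lt continuous_const (continuous_const.mul continuous_abs))
  have hsp : spectrum ℝ (T : E →L[ℂ] E) ⊆ {r : ℝ | |r| < a ∨ 3 * a < 2 * |r|} := by
    intro r hr
    by_cases hlt : |r| < 2 * a
    · left
      simpa [hgap r hr hlt] using ha
    · right
      linarith [not_lt.1 hlt]
  have hev1 : ∀ᶠ S : saFredholm ρ in nhds T,
      spectrum ℝ (S : E →L[ℂ] E) ⊆ {r : ℝ | |r| < a ∨ 3 * a < 2 * |r|} := by
    have := upperHemicontinuous_spectrum ℝ (E →L[ℂ] E) (T : E →L[ℂ] E) _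
      (hopen.mem_nhdsSet.2 hsp)
    filter_upwards [continuous_subtype_val.continuousAt.eventually this] with S hS
    exact subset_of_mem_nhdsSet hS
  have hcont : Continuous fun S : saFredholm ρ => cfc f (S : E →L[ℂ] E) :=
    Continuous.cfc_of_mem_nhdsSet (s := Set.univ) f Filter.univ_mem continuous_subtype_val
      (fun S => S.2.1) hfc.continuousOn
  have hev2 : ∀ᶠ S : saFredholm ρ in nhds T,
      ‖cfc f (S : E →L[ℂ] E) - cfc f (T : E →L[ℂ] E)‖ < 1 := by
    have := Metric.continuousAt_iff'.1 (hcont.continuousAt (x := T)) 1 one_pos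
    simpa only [dist_eq_norm] using this
  have hproj : ∀ S : saFredholm ρ,
      spectrum ℝ (S : E →L[ℂ] E) ⊆ {r : ℝ | |r| < a ∨ 3 * a < 2 * |r|} →
      spectralProjection (S : E →L[ℂ] E) (Set.Icc (-a) a) = cfc f (S : E →L[ℂ] E) := by
    intro S hS
    refine spectralProjection_eq_cfc S.2.1 hfc (fun r hr => ?_) fun r hr hra => ?_
    · have h1 : |r| / a ≤ 1 := (div_le_one ha).2 (abs_le.2 hr)
      have h2 : 1 ≤ 3 - 2 * (|r| / a) := by linarith
      simp [hf, h2]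
    · have h1 : 3 * a < 2 * |r| :=
        (hS hr).resolve_left fun h => hra (abs_le.1 h.le)
      have h2 : 3 - 2 * (|r| / a) ≤ 0 := by
        rw [sub_nonpos, ← mul_div_assoc, le_div_iff₀ ha]
        exact h1.le
      rw [hf]
      exact max_eq_left ((min_le_right _ _).trans h2)
  obtain ⟨U, hU, hUo, hTU⟩ := eventually_nhds_iff.1 (hev1.and hev2)
  refine ⟨a, ha, U, hUo, hTU, fun S hS => ?_, ?_⟩
  · have := T.2.2.1.finite_ker
    have : FiniteDimensional ℂ (spectralSubspace (T : E →L[ℂ] E) (Set.Icc (-a) a)) :=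
      Submodule.finiteDimensional_of_le (spectralSubspace_le_ker T.2.1 ha hgap)
    refine finiteDimensional_of_norm_starProjection_sub_lt
      (V := spectralSubspace (T : E →L[ℂ] E) (Set.Icc (-a) a)) ?_
    change ‖spectralProjection (S : E →L[ℂ] E) _ - spectralProjection (T : E →L[ℂ] E) _‖ < 1
    rw [hproj S (hU S hS).1, hproj T hsp]
    exact (hU S hS).2
  · exact hcont.continuousOn.congr fun S hS => hproj S (hU S hS).1

end Hilbert

section Hilbert

variable {E : Type*} [NormedAddCommGroup E] [InnerProductSpace ℂ E] [CompleteSpace E]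
variable {H : Type*} [Group H] {ρ : H →* (E →L[ℂ] E)}

/-! ### Independence of the grid -/

namespace Grid

variable (G : Grid)

/-- The `j`-th interval of the partition. -/
def cell (j : Fin G.n) : Set unitInterval := Set.Icc (G.t j.castSucc) (G.t j.succ)

theorem exists_mem_cell (s : unitInterval) : ∃ j, s ∈ G.cell j := by
  have key : ∀ j : Fin (G.n + 1), s ≤ G.t j → (∃ j, s ∈ G.cell j) ∨ s ≤ G.t 0 := by
    intro j
    induction j using Fin.induction with
    | zero => exact Or.inr
    | succ j ih =>
      intro h
      rcases le_total s (G.t j.castSucc) with h' | h'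
      · exact ih h'
      · exact Or.inl ⟨j, h', h⟩
  rcases key (Fin.last G.n) (by rw [G.t_last]; exact unitInterval.le_one') with h | h
  · exact h
  · have hn : 0 < G.n := by
      rcases Nat.eq_zero_or_pos G.n with hn | hn
      · have h0 : Fin.last G.n = 0 := Fin.ext hn
        have h1 := G.t_last
        rw [h0, G.t_zero] at h1
        exact absurd h1 zero_ne_one
      · exact hn
    refine ⟨⟨0, hn⟩, ?_, h.trans (G.strictMono_t.monotone (Fin.zero_le _))⟩
    have : (Fin.castSucc ⟨0, hn⟩ : Fin (G.n + 1)) = 0 := rfl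
    rw [this, G.t_zero]
    exact unitInterval.nonneg'

theorem isClosed_cell (j : Fin G.n) : IsClosed (G.cell j) := isClosed_Icc

variable {G} {x y : saFredholm ρ}

theorem IsGood.isWindow {B : Path x y} (hG : G.IsGood B) (j : Fin G.n) :
    IsWindow B (G.cell j) (G.a j) := hG j

/-- The part of the flow that accumulates up to the time `s`. -/
def partialFlow (G : Grid) (h : H) (B : Path x y) (s : unitInterval) : ℂ :=
  ∑ j : Fin G.n,
    (spectralTrace h (B (max (G.t j.castSucc) (min s (G.t j.succ)))) (G.a j) -
      spectralTrace h (B (G.t j.castSucc)) (G.a j))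

theorem partialFlow_zero (G : Grid) (h : H) (B : Path x y) : G.partialFlow h B 0 = 0 := by
  refine Finset.sum_eq_zero fun j _ => ?_
  rw [min_eq_left unitInterval.nonneg', max_eq_left unitInterval.nonneg', sub_self]

theorem partialFlow_one (G : Grid) (h : H) (B : Path x y) :
    G.partialFlow h B 1 = G.flow h B := by
  refine Finset.sum_congr rfl fun j _ => ?_
  rw [min_eq_right unitInterval.le_one',
    max_eq_right (G.strictMono_t.monotone (Fin.castSucc_le_succ j))]

theorem partialFlow_sub (G : Grid) (h : H) (B : Path x y) {k : Fin G.n} {s s' : unitInterval}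
    (hs : s ∈ G.cell k) (hs' : s' ∈ G.cell k) :
    G.partialFlow h B s' - G.partialFlow h B s =
      spectralTrace h (B s') (G.a k) - spectralTrace h (B s) (G.a k) := by
  rw [partialFlow, partialFlow, ← Finset.sum_sub_distrib, Finset.sum_eq_single k]
  · rw [min_eq_left hs.2, min_eq_left hs'.2, max_eq_right hs.1, max_eq_right hs'.1]
    ring
  · intro j _ hjk
    rcases lt_or_gt_of_ne hjk with hlt | hlt
    · have hle : G.t j.succ ≤ G.t k.castSucc :=
        G.strictMono_t.monotone (Fin.succ_le_castSucc_iff.2 hlt)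
      rw [min_eq_right (hle.trans hs.1), min_eq_right (hle.trans hs'.1), sub_self]
    · have hle : G.t k.succ ≤ G.t j.castSucc :=
        G.strictMono_t.monotone (Fin.succ_le_castSucc_iff.2 hlt)
      rw [max_eq_left ((min_le_left _ _).trans (hs.2.trans hle)),
        max_eq_left ((min_le_left _ _).trans (hs'.2.trans hle)), sub_self]
  · simp

theorem eventually_mem_cell_imp (G : Grid) (s : unitInterval) :
    ∀ᶠ s' in nhds s, ∀ j, s' ∈ G.cell j → s ∈ G.cell j := by
  rw [Filter.eventually_all]
  intro j
  by_cases hs : s ∈ G.cell j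
  · exact Filter.Eventually.of_forall fun _ _ => hs
  · filter_upwards [(G.isClosed_cell j).isOpen_compl.mem_nhds hs] with s' hs' h
    exact absurd h hs'

theorem IsGood.flow_eq {G' : Grid} {B : Path x y} (hG : G.IsGood B) (hG' : G'.IsGood B) (h : H) :
    G.flow h B = G'.flow h B := by
  have hloc : IsLocallyConstant fun s => G.partialFlow h B s - G'.partialFlow h B s := by
    rw [IsLocallyConstant.iff_eventually_eq]
    intro s
    filter_upwards [G.eventually_mem_cell_imp s, G'.eventually_mem_cell_imp s] with s' h1 h2
    obtain ⟨j, hj⟩ := G.exists_mem_cell s'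
    obtain ⟨k, hk⟩ := G'.exists_mem_cell s'
    have e1 := G.partialFlow_sub h B (h1 j hj) hj
    have e2 := G'.partialFlow_sub h B (h2 k hk) hk
    have e3 := IsWindow.spectralTrace_sub_eq (T := B) (S := G.cell j ∩ G'.cell k)
      B.continuous.continuousOn (Set.ordConnected_Icc.inter Set.ordConnected_Icc).isPreconnected
      (G.a_pos j) (G'.a_pos k) ((hG.isWindow j).mono Set.inter_subset_left)
      ((hG'.isWindow k).mono Set.inter_subset_right) h ⟨h1 j hj, h2 k hk⟩ ⟨hj, hk⟩
    linear_combination e1 - e2 + e3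
  have := hloc.apply_eq_of_preconnectedSpace 0 1
  simp only [partialFlow_zero, partialFlow_one, sub_self] at this
  exact (sub_eq_zero.1 this.symm)

theorem IsGood.flow_eq_spectralFlow {B : Path x y} (hG : G.IsGood B) (h : H) :
    G.flow h B = spectralFlow h B := by
  have hex : ∃ G : Grid, G.IsGood B := ⟨G, hG⟩
  rw [spectralFlow, dif_pos hex]
  exact hG.flow_eq (Classical.choose_spec hex) h

end Grid

/-! ### Homotopy invariance -/

variable {x y : saFredholm ρ}

/-- Two stages of a homotopy have the same spectral flow if a single grid has admissible windows on
the strip between them. -/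
theorem spectralFlow_eval_eq {B B' : Path x y} (F : Path.Homotopy B B') (h : H)
    {l l' : unitInterval} (hl : l ≤ l') (G : Grid)
    (hG : ∀ j, IsWindow F (Set.Icc l l' ×ˢ G.cell j) (G.a j)) :
    spectralFlow h (F.eval l) = spectralFlow h (F.eval l') := by
  have hgood : ∀ r ∈ Set.Icc l l', G.IsGood (F.eval r) := fun r hr j =>
    (hG j).comp (g := fun s => (r, s)) (by fun_prop) fun s hs => ⟨hr, hs⟩
  rw [← (hgood l ⟨le_rfl, hl⟩).flow_eq_spectralFlow h,
    ← (hgood l' ⟨hl, le_rfl⟩).flow_eq_spectralFlow h]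
  choose i hi using G.exists_mem_cell
  set d : unitInterval → ℂ := fun s =>
    spectralTrace h (F (l', s)) (G.a (i s)) - spectralTrace h (F (l, s)) (G.a (i s)) with hd
  have hvert : ∀ s j, s ∈ G.cell j →
      IsWindow (fun r => F (r, s)) (Set.Icc l l') (G.a j) := fun s j hs =>
    (hG j).comp (g := fun r => (r, s)) (by fun_prop) fun r hr => ⟨hr, hs⟩
  have hdj : ∀ s j, s ∈ G.cell j →
      spectralTrace h (F (l', s)) (G.a j) - spectralTrace h (F (l, s)) (G.a j) = d s := by
    intro s j hs
    exact IsWindow.spectralTrace_sub_eq (T := fun r => F (r, s)) (by fun_prop) isPreconnected_Icc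
      (G.a_pos j) (G.a_pos (i s)) (hvert s j hs) (hvert s (i s) (hi s)) h
      (s := l) (t := l') ⟨le_rfl, hl⟩ ⟨hl, le_rfl⟩
  have h0 : d 0 = 0 := by simp [hd]
  have h1 : d 1 = 0 := by simp [hd]
  have htel : ∑ j : Fin G.n, (d (G.t j.succ) - d (G.t j.castSucc)) = 0 := by
    have e1 := Fin.sum_univ_succ fun j => d (G.t j)
    have e2 := Fin.sum_univ_castSucc fun j => d (G.t j)
    rw [G.t_zero, h0] at e1
    rw [G.t_last, h1] at e2
    rw [Finset.sum_sub_distrib]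
    linear_combination e2 - e1
  rw [eq_comm, ← sub_eq_zero, ← htel, Grid.flow, Grid.flow, ← Finset.sum_sub_distrib]
  refine Finset.sum_congr rfl fun j _ => ?_
  have hle := G.strictMono_t.monotone (Fin.castSucc_le_succ j)
  rw [← hdj (G.t j.succ) j ⟨hle, le_rfl⟩, ← hdj (G.t j.castSucc) j ⟨le_rfl, hle⟩]
  change spectralTrace h (F (l', _)) _ - spectralTrace h (F (l', _)) _ -
    (spectralTrace h (F (l, _)) _ - spectralTrace h (F (l, _)) _) = _
  ring

end Hilbert

section UniformGrid

/-- The point `k / n` of the unit interval, clamped at `1`. -/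
def uniformPoint (n k : ℕ) : unitInterval :=
  Set.projIcc 0 1 zero_le_one ((k : ℝ) / n)

theorem coe_uniformPoint {n k : ℕ} (h : k ≤ n) : (uniformPoint n k : ℝ) = (k : ℝ) / n := by
  rw [uniformPoint, Set.projIcc_of_mem]
  exact ⟨by positivity, div_le_one_of_le₀ (by exact_mod_cast h) (by positivity)⟩

theorem uniformPoint_zero (n : ℕ) : uniformPoint n 0 = 0 :=
  Subtype.ext (by simp [coe_uniformPoint])

theorem uniformPoint_self {n : ℕ} (hn : 0 < n) : uniformPoint n n = 1 :=
  Subtype.ext (by rw [coe_uniformPoint le_rfl, div_self (by positivity)]; rfl)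

theorem uniformPoint_lt {n k l : ℕ} (hkl : k < l) (hl : l ≤ n) :
    uniformPoint n k < uniformPoint n l := by
  rw [← Subtype.coe_lt_coe, coe_uniformPoint (hkl.le.trans hl), coe_uniformPoint hl]
  have hn : (0 : ℝ) < n := by exact_mod_cast (by omega : 0 < n)
  exact (div_lt_div_iff_of_pos_right hn).2 (by exact_mod_cast hkl)

theorem dist_uniformPoint_le {n k : ℕ} (hk : k < n) {s : unitInterval}
    (hs : s ∈ Set.Icc (uniformPoint n k) (uniformPoint n (k + 1))) :
    dist s (uniformPoint n k) ≤ 1 / n := by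
  have h1 : (uniformPoint n k : ℝ) ≤ s := hs.1
  have h2 : (s : ℝ) ≤ uniformPoint n (k + 1) := hs.2
  rw [Subtype.dist_eq, Real.dist_eq, abs_of_nonneg (sub_nonneg.2 h1)]
  rw [coe_uniformPoint hk] at h2
  rw [coe_uniformPoint hk.le]
  push_cast at h2
  rw [add_div] at h2
  linarith

/-- The grid with the partition points `k / n`. -/
def uniformGrid (n : ℕ) (hn : 0 < n) (a : Fin n → ℝ) (ha : ∀ j, 0 < a j) : Grid where
  n := n
  t k := uniformPoint n k
  a := a
  strictMono_t _ l hkl := uniformPoint_lt hkl (Nat.lt_succ_iff.1 l.2)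
  t_zero := uniformPoint_zero n
  t_last := uniformPoint_self hn
  a_pos := ha

end UniformGrid

section Hilbert

variable {E : Type*} [NormedAddCommGroup E] [InnerProductSpace ℂ E] [CompleteSpace E]
variable {H : Type*} [Group H] {ρ : H →* (E →L[ℂ] E)} {x y : saFredholm ρ}

/-- A homotopy has admissible windows on the squares of a sufficiently fine subdivision. -/
theorem exists_isWindow_uniform {B B' : Path x y} (F : Path.Homotopy B B') :
    ∃ n : ℕ, 0 < n ∧ ∀ k < n, ∀ j < n, ∃ a > 0,
      IsWindow F (Set.Icc (uniformPoint n k) (uniformPoint n (k + 1)) ×ˢ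
        Set.Icc (uniformPoint n j) (uniformPoint n (j + 1))) a := by
  choose a ha U hUo hmem hU using exists_isWindow (ρ := ρ)
  obtain ⟨δ, hδ, hball⟩ := lebesgue_number_lemma_of_metric
    (s := (Set.univ : Set (unitInterval × unitInterval))) (c := fun T => F ⁻¹' U T) isCompact_univ
    (fun T => (hUo T).preimage F.continuous) fun p _ => Set.mem_iUnion.2 ⟨F p, hmem _⟩
  obtain ⟨n, hn⟩ := exists_nat_one_div_lt hδ
  refine ⟨n + 1, n.succ_pos, fun k hk j hj => ?_⟩
  obtain ⟨T, hT⟩ := hball (uniformPoint (n + 1) k, uniformPoint (n + 1) j) trivial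
  refine ⟨a T, ha T, (hU T).comp F.continuous fun p hp => hT ?_⟩
  rw [Metric.mem_ball, Prod.dist_eq]
  refine lt_of_le_of_lt (max_le (dist_uniformPoint_le hk hp.1) (dist_uniformPoint_le hj hp.2)) ?_
  push_cast
  exact hn

theorem exists_isGood (B : Path x y) : ∃ G : Grid, G.IsGood B := by
  obtain ⟨n, hn, hw⟩ := exists_isWindow_uniform (Path.Homotopy.refl B)
  choose a ha hw using fun j : Fin n => hw 0 hn j j.2
  refine ⟨uniformGrid n hn a ha, fun j => ?_⟩
  exact (hw j).comp (g := fun s => (uniformPoint n 0, s)) (by fun_prop) fun s hs =>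
    ⟨⟨le_rfl, (uniformPoint_lt one_pos hn).le⟩, hs⟩

theorem spectralFlow_eq_of_homotopic {B B' : Path x y} (hom : B.Homotopic B') (h : H) :
    spectralFlow h B = spectralFlow h B' := by
  obtain ⟨F⟩ := hom
  obtain ⟨n, hn, hw⟩ := exists_isWindow_uniform F
  have key : ∀ k ≤ n, spectralFlow h (F.eval 0) = spectralFlow h (F.eval (uniformPoint n k)) := by
    intro k
    induction k with
    | zero => intro _; rw [uniformPoint_zero]
    | succ k ih =>
      intro hk
      choose a ha hw using fun j : Fin n => hw k hk j j.2
      exact (ih (Nat.le_of_succ_le hk)).trans (spectralFlow_eval_eq F h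
        (uniformPoint_lt k.lt_succ_self hk).le (uniformGrid n hn a ha) fun j => hw j)
  have := key n le_rfl
  rwa [uniformPoint_self hn, F.eval_zero, F.eval_one] at this

end Hilbert

end EquivariantSpectralFlow

end

theorem mainTheorem9 {H : Type*} [Group H] [TopologicalSpace H] [IsTopologicalGroup H]
    [CompactSpace H] [MeasurableSpace H] [BorelSpace H]
    (μ : MeasureTheory.Measure H) [μ.IsHaarMeasure]
    {𝓗 : Type*} [NormedAddCommGroup 𝓗] [InnerProductSpace ℂ 𝓗] [CompleteSpace 𝓗]
    (h : H)
    {B₀ B₁ : EquivariantSpectralFlow.saFredholm (EquivariantSpectralFlow.regularRep μ 𝓗)}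
    (B B' : Path B₀ B₁) (hom : B.Homotopic B') :
    (∃ G : EquivariantSpectralFlow.Grid, G.IsGood B) ∧
    (∀ G : EquivariantSpectralFlow.Grid, G.IsGood B →
      G.flow h B = EquivariantSpectralFlow.spectralFlow h B) ∧
    EquivariantSpectralFlow.spectralFlow h B = EquivariantSpectralFlow.spectralFlow h B' :=
  ⟨EquivariantSpectralFlow.exists_isGood B, fun _ hG => hG.flow_eq_spectralFlow h,
    EquivariantSpectralFlow.spectralFlow_eq_of_homotopic hom h⟩
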